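/- For $\theta>0$ let $f(x|\theta)=\frac1\theta e^{-x/\theta}\mathbf 1_{\{x>0\}}$ be the density of the exponential distribution $\mathrm{Exp}(1/\theta)$ with rate $1/\theta$ (mean $\theta$), with parameter space $\Theta=(0,\infty)$. Let $\theta_0>0$, let $n>3$ be an integer, and let $X_1,\dots,X_n$ be i.i.d. random variables with the $\mathrm{Exp}(1/\theta_0)$ distribution. For every sample $x\in(0,\infty)^n$ the likelihood $\theta\mapsto\prod_{i=1}^n f(x_i|\theta)$ has a unique maximiser over $\Theta$, namely the sample mean $\bar x=\frac1n\sum_{i=1}^n x_i$; let $\hat\theta_n(X)$ denote this maximum likelihood estimator, evaluated at $X=(X_1,\dots,X_n)$. Let $i(\theta_0)=\mathrm{Var}\big(\frac{\partial}{\partial\theta}\log f(X_1|\theta)\big|_{\theta=\theta_0}\big)$ be the expected Fisher information of one observation, let $$W=\sqrt{n\,i(\theta_0)}\,\big(\hat\theta_n(X)-\theta_0\big),$$ and let $Z\sim\mathrm N(0,1)$. Then $$d_{\mathrm W}(W,Z)<\frac{10.41456}{\sqrt n}+\frac{4n^{3/2}(n+6)}{(n-1)(n-2)(n-3)}+\frac{6}{n^{3/2}},$$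 where $d_{\mathrm W}(W,Z)=\inf\mathbb E|W'-Z'|$ is the 1-Wasserstein distance, the infimum being over all joint distributions of pairs $(W',Z')$ such that $W'$ has the law of $W$ and $Z'$ has the law of $Z$. In particular the bound does not depend on $\theta_0$. -/

import Mathlib

open MeasureTheory ProbabilityTheory
open scoped ENNReal

/-- The density at `x` of the exponential distribution with mean `θ` (that is, with rate `1 / θ`),
`f(x|θ) = (1 / θ) exp (-x / θ)`, parametrised by its mean `θ ∈ Θ = (0, ∞)`. -/
noncomputable def expMeanDensity (θ x : ℝ) : ℝ := exponentialPDFReal (1 / θ) x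

/-- The likelihood `L(θ; x) = ∏ i, f(x i | θ)` of a sample `x` under the family of densities `f`. -/
noncomputable def likelihood (f : ℝ → ℝ → ℝ) {n : ℕ} (x : Fin n → ℝ) (θ : ℝ) : ℝ :=
  ∏ i, f θ (x i)

/-- `θ` is a maximum likelihood estimate for the sample `x`: it lies in the parameter space `Θ`
and maximises the likelihood over `Θ`. -/
def IsMaxLikelihoodEstimate (f : ℝ → ℝ → ℝ) (Θ : Set ℝ) {n : ℕ} (x : Fin n → ℝ) (θ : ℝ) : Prop :=
  θ ∈ Θ ∧ ∀ θ' ∈ Θ, likelihood f x θ' ≤ likelihood f x θ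

/-- The expected Fisher information `i(θ)` of a single observation: the variance, under the law
with density `f(·|θ)`, of the score `x ↦ ∂/∂θ log f(x|θ)`. -/
noncomputable def fisherInformation (f : ℝ → ℝ → ℝ) (θ : ℝ) : ℝ :=
  variance (fun x => deriv (fun t => Real.log (f t x)) θ)
    (volume.withDensity fun x => ENNReal.ofReal (f θ x))

/-- The 1-Wasserstein distance between two laws on the real line: the infimum of `𝔼|X' - Y'|` over
all joint laws `π` of pairs `(X', Y')` with marginals `P` and `Q`, as an extended nonnegative real
number. -/
noncomputable def wassersteinDist (P Q : Measure ℝ) : ℝ≥0∞ :=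
  ⨅ (π : Measure (ℝ × ℝ)) (_ : π.map Prod.fst = P ∧ π.map Prod.snd = Q),
    ∫⁻ z, ENNReal.ofReal |z.1 - z.2| ∂π

/-! The maximiser is the sample mean and `i(θ₀) = 1 / θ₀ ^ 2`, so W is almost surely the
standardisation of a sum of n exponentials, that is, of a Gamma variable with shape n. Its law is
explicit and the bound comes from Stein's method with an exact Stein kernel, giving 4 / √n; the last
two terms of the claimed bound are only needed to be nonnegative.

Write w for the standardised variable with shape a, and u = Φ / φ, so that u' = 1 + x u. The
identity s p_a(s) = (a / r) p_{a+1}(s) shows that the Stein kernel is affine: E[(1 + w / √a) f'(w) -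
w f(w)] = 0 (`hasDerivAt_comp_gammaStd_mul`). Take for f the solution f_y of f' - x f = 1_{x ≤ y} -
Φ(y), which is (1 - Φ(y)) u(x) for x ≤ y and Φ(y) u(-x) for x > y. Then P(w ≤ y) - Φ(y) = -E[w
f_y'(w)] / √a (`abs_cdf_sub_stdNormalCDF_le`).

The quantile coupling bounds the Wasserstein distance by the integral over y of |P(w ≤ y) - Φ(y)|
(`wassersteinDist_le_lintegral_cdf`). By Tonelli it remains to see that ∫ |f_y'(x)| dy = 2 φ(x)
u'(x) u'(-x) ≤ 4 for every x (`lintegral_steinKernel_le`) and that E|w| ≤ 1. -/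

/-! ### Quantile coupling and the L¹ distance of distribution functions. -/

section QuantileCoupling

open Set Filter Topology

/-- The quantile function of a law on the real line. -/
noncomputable def quantile (P : Measure ℝ) (u : ℝ) : ℝ := sInf {x | u ≤ cdf P x}

/-- Right-continuity of the distribution function makes the infimum attained. For u in (0, 1) the
set is nonempty and bounded below; outside, `sInf` may take its default value 0. -/
theorem quantile_le_iff (P : Measure ℝ) {u : ℝ} (hu : u ∈ Ioo (0 : ℝ) 1) (x : ℝ) :
    quantile P u ≤ x ↔ u ≤ cdf P x := by
  have hne : {x | u ≤ cdf P x}.Nonempty :=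
    ((tendsto_cdf_atTop P).eventually (eventually_ge_nhds hu.2)).exists
  obtain ⟨a, ha⟩ := ((tendsto_cdf_atBot P).eventually (eventually_lt_nhds hu.1)).exists
  have hbdd : BddBelow {x | u ≤ cdf P x} := by
    refine ⟨a, fun y hy => ?_⟩
    by_contra h
    exact absurd (hy.out.trans (monotone_cdf P (not_le.1 h).le)) (not_le.2 ha)
  refine ⟨fun h => ?_, fun h => csInf_le hbdd h⟩
  have hright : Tendsto (cdf P) (𝓝[>] x) (𝓝 (cdf P x)) :=
    ((cdf P).right_continuous x).tendsto.mono_left (nhdsWithin_mono _ Ioi_subset_Ici_self)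
  refine ge_of_tendsto hright ?_
  filter_upwards [self_mem_nhdsWithin] with y hy
  obtain ⟨z, hz, hzy⟩ := exists_lt_of_csInf_lt hne (h.trans_lt hy)
  exact hz.out.trans (monotone_cdf P hzy.le)

theorem aemeasurable_quantile (P : Measure ℝ) :
    AEMeasurable (quantile P) (volume.restrict (Ioo 0 1)) := by
  refine aemeasurable_restrict_of_monotoneOn measurableSet_Ioo fun u hu v hv huv => ?_
  rw [quantile_le_iff P hu]
  exact huv.trans ((quantile_le_iff P hv _).1 le_rfl)

theorem map_quantile (P : Measure ℝ) [IsProbabilityMeasure P] :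
    (volume.restrict (Ioo 0 1)).map (quantile P) = P := by
  have : IsFiniteMeasure (volume.restrict (Ioo (0 : ℝ) 1)) := ⟨by simp⟩
  refine Measure.ext_of_Iic _ _ fun x => ?_
  rw [Measure.map_apply_of_aemeasurable (aemeasurable_quantile P) measurableSet_Iic,
    Measure.restrict_apply' measurableSet_Ioo, ← ofReal_cdf P x]
  have h : quantile P ⁻¹' Iic x ∩ Ioo 0 1 = Iic (cdf P x) ∩ Ioo 0 1 := by
    ext u
    simp only [mem_inter_iff, mem_preimage, mem_Iic]
    exact and_congr_left fun hu => quantile_le_iff P hu x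
  rw [h]
  have h0 := cdf_nonneg P x
  have h1 := cdf_le_one P x
  refine le_antisymm ?_ ?_
  · calc volume (Iic (cdf P x) ∩ Ioo 0 1) ≤ volume (Ioc 0 (cdf P x)) :=
        measure_mono fun u hu => mem_Ioc.2 ⟨hu.2.1, hu.1⟩
      _ = _ := by simp
  · calc ENNReal.ofReal (cdf P x) = volume (Ioo 0 (cdf P x)) := by simp
      _ ≤ volume (Iic (cdf P x) ∩ Ioo 0 1) :=
        measure_mono fun u hu => ⟨mem_Iic.2 hu.2.le, mem_Ioo.2 ⟨hu.1, hu.2.trans_le h1⟩⟩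

/-- The points y that separate a from b form an interval. Writing |a - b| this way prepares an
exchange of integrals. -/
theorem lintegral_indicator_not_iff (a b : ℝ) :
    ∫⁻ y, indicator {y | ¬(a ≤ y ↔ b ≤ y)} 1 y = ENNReal.ofReal |a - b| := by
  have h : {y | ¬(a ≤ y ↔ b ≤ y)} = Ico (min a b) (max a b) := by
    ext y
    simp only [mem_ofPred_eq, mem_Ico, min_le_iff, lt_max_iff]
    by_cases h1 : a ≤ y <;> by_cases h2 : b ≤ y <;> simp [h1, h2] <;> grind
  rw [h, lintegral_indicator_one measurableSet_Ico, Real.volume_Ico, max_sub_min_eq_abs, abs_sub_comm]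

theorem lintegral_indicator_not_iff_left (a b : ℝ) :
    ∫⁻ u, indicator {u | ¬(u ≤ a ↔ u ≤ b)} 1 u = ENNReal.ofReal |a - b| := by
  have h : {u | ¬(u ≤ a ↔ u ≤ b)} = Ioc (min a b) (max a b) := by
    ext y
    simp only [mem_ofPred_eq, mem_Ioc, le_max_iff, min_lt_iff]
    by_cases h1 : y ≤ a <;> by_cases h2 : y ≤ b <;> simp [h1, h2] <;> grind
  rw [h, lintegral_indicator_one measurableSet_Ioc, Real.volume_Ioc, max_sub_min_eq_abs, abs_sub_comm]

/-- The quantile coupling bounds the Wasserstein distance by the `L¹` distance of the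
distribution functions. -/
theorem wassersteinDist_le_lintegral_cdf (P Q : Measure ℝ) [IsProbabilityMeasure P]
    [IsProbabilityMeasure Q] :
    wassersteinDist P Q ≤ ∫⁻ y, ENNReal.ofReal |cdf P y - cdf Q y| := by
  have hP := aemeasurable_quantile P
  have hQ := aemeasurable_quantile Q
  have hmarg : ((volume.restrict (Ioo 0 1)).map fun u => (quantile P u, quantile Q u)).map Prod.fst = P ∧
      ((volume.restrict (Ioo 0 1)).map fun u => (quantile P u, quantile Q u)).map Prod.snd = Q := by
    rw [AEMeasurable.map_map_of_aemeasurable measurable_fst.aemeasurable (hP.prodMk hQ),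
      AEMeasurable.map_map_of_aemeasurable measurable_snd.aemeasurable (hP.prodMk hQ)]
    exact ⟨map_quantile P, map_quantile Q⟩
  refine (iInf₂_le (f := fun (π : Measure (ℝ × ℝ)) (_ : π.map Prod.fst = P ∧
    π.map Prod.snd = Q) => ∫⁻ z, ENNReal.ofReal |z.1 - z.2| ∂π) _ hmarg).trans ?_
  rw [lintegral_map' (by fun_prop) (hP.prodMk hQ)]
  have hmeas : Measurable fun p : ℝ × ℝ =>
      indicator {p : ℝ × ℝ | ¬(p.1 ≤ cdf P p.2 ↔ p.1 ≤ cdf Q p.2)} (1 : ℝ × ℝ → ℝ≥0∞) p := by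
    refine measurable_one.indicator ?_
    have h1 : MeasurableSet {p : ℝ × ℝ | p.1 ≤ cdf P p.2} :=
      measurableSet_le measurable_fst ((monotone_cdf P).measurable.comp measurable_snd)
    have h2 : MeasurableSet {p : ℝ × ℝ | p.1 ≤ cdf Q p.2} :=
      measurableSet_le measurable_fst ((monotone_cdf Q).measurable.comp measurable_snd)
    exact (h1.iff h2).compl
  -- By `quantile_le_iff`, y separates the two quantiles at u exactly when u separates the two
  -- distribution functions at y; Tonelli then measures the same planar set along the other axis.
  calc ∫⁻ u in Ioo (0 : ℝ) 1, ENNReal.ofReal |quantile P u - quantile Q u|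
      = ∫⁻ u in Ioo (0 : ℝ) 1, ∫⁻ y, indicator {p : ℝ × ℝ | ¬(p.1 ≤ cdf P p.2 ↔ p.1 ≤ cdf Q p.2)}
          (1 : ℝ × ℝ → ℝ≥0∞) (u, y) := by
        refine setLIntegral_congr_fun measurableSet_Ioo fun u hu => ?_
        rw [← lintegral_indicator_not_iff]
        refine lintegral_congr fun y => ?_
        simp only [indicator, mem_ofPred_eq, quantile_le_iff _ hu, Pi.one_apply]
    _ = ∫⁻ y, ∫⁻ u in Ioo (0 : ℝ) 1, indicator {p : ℝ × ℝ | ¬(p.1 ≤ cdf P p.2 ↔ p.1 ≤ cdf Q p.2)}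
          (1 : ℝ × ℝ → ℝ≥0∞) (u, y) :=
        lintegral_lintegral_swap hmeas.aemeasurable
    _ ≤ ∫⁻ y, ENNReal.ofReal |cdf P y - cdf Q y| := by
        refine lintegral_mono fun y => ?_
        rw [← lintegral_indicator_not_iff_left]
        exact setLIntegral_le_lintegral _ _

end QuantileCoupling

/-! ### Normal tails, the Mills ratio and the Stein solution for half-lines. -/

section GaussianMills

open Set Filter Topology

/-- The standard normal density. -/
noncomputable def stdNormalPDF (x : ℝ) : ℝ := gaussianPDFReal 0 1 x

/-- The standard normal distribution function. -/
noncomputable def stdNormalCDF (x : ℝ) : ℝ := cdf (gaussianReal 0 1) x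

theorem stdNormalPDF_eq (x : ℝ) :
    stdNormalPDF x = (√(2 * Real.pi))⁻¹ * Real.exp (-x ^ 2 / 2) := by
  simp [stdNormalPDF, gaussianPDFReal]

theorem stdNormalPDF_pos (x : ℝ) : 0 < stdNormalPDF x := gaussianPDFReal_pos 0 1 x one_ne_zero

theorem stdNormalPDF_neg (x : ℝ) : stdNormalPDF (-x) = stdNormalPDF x := by
  simp [stdNormalPDF_eq]

theorem inv_sqrt_two_pi_le_one : (√(2 * Real.pi))⁻¹ ≤ 1 := by
  refine inv_le_one_of_one_le₀ (Real.one_le_sqrt.2 ?_)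
  linarith [Real.pi_gt_three]

/-- This is (x + 1)² ≥ 0 in the exponent. The exponential majorant is crude but settles the limits
at -∞. -/
theorem stdNormalPDF_le_exp (x : ℝ) : stdNormalPDF x ≤ Real.exp (x + 1 / 2) := by
  rw [stdNormalPDF_eq]
  calc _ ≤ 1 * Real.exp (x + 1 / 2) := by
        refine mul_le_mul inv_sqrt_two_pi_le_one (Real.exp_le_exp.2 ?_) (Real.exp_pos _).le zero_le_one
        nlinarith [sq_nonneg (x + 1)]
    _ = _ := one_mul _

theorem stdNormalPDF_le_one (x : ℝ) : stdNormalPDF x ≤ 1 := by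
  rw [stdNormalPDF_eq]
  refine mul_le_one₀ inv_sqrt_two_pi_le_one (Real.exp_pos _).le (Real.exp_le_one_iff.2 ?_)
  nlinarith [sq_nonneg x]

theorem hasDerivAt_stdNormalPDF (x : ℝ) :
    HasDerivAt stdNormalPDF (-(x * stdNormalPDF x)) x := by
  have h : HasDerivAt (fun x : ℝ => (√(2 * Real.pi))⁻¹ * Real.exp (-x ^ 2 / 2)) _ x :=
    ((((hasDerivAt_id x).pow 2).neg.div_const 2).exp).const_mul _
  rw [← funext stdNormalPDF_eq] at h
  refine h.congr_deriv ?_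
  rw [stdNormalPDF_eq]
  simp
  ring

theorem continuous_stdNormalPDF : Continuous stdNormalPDF :=
  continuous_iff_continuousAt.2 fun x => (hasDerivAt_stdNormalPDF x).continuousAt

theorem stdNormalCDF_nonneg (x : ℝ) : 0 ≤ stdNormalCDF x := cdf_nonneg _ x

theorem stdNormalCDF_le_one (x : ℝ) : stdNormalCDF x ≤ 1 := cdf_le_one _ x

theorem stdNormalCDF_eq_integral (x : ℝ) : stdNormalCDF x = ∫ y in Iic x, stdNormalPDF y := by
  rw [stdNormalCDF, cdf_eq_real, measureReal_def, gaussianReal_apply_eq_integral 0 one_ne_zero,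
    ENNReal.toReal_ofReal]
  · rfl
  · exact integral_nonneg fun y => gaussianPDFReal_nonneg _ _ _

theorem hasDerivAt_stdNormalCDF (x : ℝ) : HasDerivAt stdNormalCDF (stdNormalPDF x) x := by
  have hint : Integrable stdNormalPDF := integrable_gaussianPDFReal 0 1
  have h := (intervalIntegral.integral_hasDerivAt_right (a := 0) (b := x)
    hint.intervalIntegrable
    (continuous_stdNormalPDF.stronglyMeasurableAtFilter _ _)
    continuous_stdNormalPDF.continuousAt).const_add (stdNormalCDF 0)
  refine h.congr_of_eventuallyEq (Eventually.of_forall fun y => ?_)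
  simp only []
  rw [stdNormalCDF_eq_integral, stdNormalCDF_eq_integral,
    ← intervalIntegral.integral_Iic_sub_Iic hint.integrableOn hint.integrableOn]
  ring

theorem continuous_stdNormalCDF : Continuous stdNormalCDF :=
  continuous_iff_continuousAt.2 fun x => (hasDerivAt_stdNormalCDF x).continuousAt

theorem tendsto_stdNormalCDF_atBot : Tendsto stdNormalCDF atBot (𝓝 0) := tendsto_cdf_atBot _

theorem tendsto_stdNormalCDF_atTop : Tendsto stdNormalCDF atTop (𝓝 1) := tendsto_cdf_atTop _

theorem stdNormalCDF_neg (x : ℝ) : stdNormalCDF (-x) = 1 - stdNormalCDF x := by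
  have hd : ∀ x, HasDerivAt (fun x => stdNormalCDF (-x) + stdNormalCDF x) 0 x := fun x => by
    have h := ((hasDerivAt_stdNormalCDF (-x)).scomp x (hasDerivAt_neg x)).add
      (hasDerivAt_stdNormalCDF x)
    refine h.congr_deriv ?_
    simp [stdNormalPDF_neg]
  have hconst := is_const_of_deriv_eq_zero (fun x => (hd x).differentiableAt) fun x => (hd x).deriv
  have hlim : Tendsto (fun x => stdNormalCDF (-x) + stdNormalCDF x) atTop (𝓝 (0 + 1)) :=
    (tendsto_stdNormalCDF_atBot.comp tendsto_neg_atTop_atBot).add tendsto_stdNormalCDF_atTop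
  have h : stdNormalCDF (-x) + stdNormalCDF x = 0 + 1 :=
    tendsto_nhds_unique (tendsto_const_nhds.congr fun y => hconst x y) hlim
  linarith

theorem tendsto_stdNormalPDF_atBot : Tendsto stdNormalPDF atBot (𝓝 0) := by
  refine squeeze_zero (fun x => (stdNormalPDF_pos x).le) stdNormalPDF_le_exp ?_
  exact Real.tendsto_exp_atBot.comp (tendsto_atBot_add_const_right _ _ tendsto_id)

theorem nonneg_of_hasDerivAt_of_tendsto_atBot {f f' : ℝ → ℝ} (hf : ∀ x, HasDerivAt f (f' x) x)
    (hf' : ∀ x, 0 ≤ f' x) (hlim : Tendsto f atBot (𝓝 0)) (x : ℝ) : 0 ≤ f x :=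
  (monotone_of_hasDerivAt_nonneg hf hf').le_of_tendsto hlim x

theorem stdNormalCDF_le_exp (x : ℝ) : stdNormalCDF x ≤ Real.exp (x + 1 / 2) := by
  have hd : ∀ x, HasDerivAt (fun x => Real.exp (x + 1 / 2) - stdNormalCDF x)
      (Real.exp (x + 1 / 2) - stdNormalPDF x) x := fun x => by
    have h := (((hasDerivAt_id x).add_const (1 / 2 : ℝ)).exp).sub (hasDerivAt_stdNormalCDF x)
    refine h.congr_deriv ?_
    simp
  have hlim : Tendsto (fun x => Real.exp (x + 1 / 2) - stdNormalCDF x) atBot (𝓝 (0 - 0)) :=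
    (Real.tendsto_exp_atBot.comp (tendsto_atBot_add_const_right _ _ tendsto_id)).sub
      tendsto_stdNormalCDF_atBot
  rw [sub_zero] at hlim
  exact sub_nonneg.1 (nonneg_of_hasDerivAt_of_tendsto_atBot hd
    (fun x => sub_nonneg.2 (stdNormalPDF_le_exp x)) hlim x)

theorem tendsto_mul_stdNormalCDF_atBot : Tendsto (fun x => x * stdNormalCDF x) atBot (𝓝 0) := by
  have h : Tendsto (fun x : ℝ => |x * stdNormalCDF x|) atBot (𝓝 0) := by
    have hlim : Tendsto (fun x : ℝ => Real.exp (1 / 2) * ((-x) ^ 1 * Real.exp (-(-x)))) atBot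
        (𝓝 (Real.exp (1 / 2) * 0)) :=
      ((Real.tendsto_pow_mul_exp_neg_atTop_nhds_zero 1).comp tendsto_neg_atBot_atTop).const_mul _
    rw [mul_zero] at hlim
    refine squeeze_zero' (Eventually.of_forall fun x => abs_nonneg _) ?_ hlim
    filter_upwards [eventually_le_atBot 0] with x hx
    rw [abs_mul, abs_of_nonpos hx, abs_of_nonneg (stdNormalCDF_nonneg x)]
    calc -x * stdNormalCDF x ≤ -x * Real.exp (x + 1 / 2) :=
          mul_le_mul_of_nonneg_left (stdNormalCDF_le_exp x) (by linarith)
      _ = _ := by rw [Real.exp_add, neg_neg]; ring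
  exact (tendsto_zero_iff_abs_tendsto_zero _).2 h

/-- The integrated distribution function `x ↦ ∫ y in Iic x, stdNormalCDF y`, in closed form. -/
noncomputable def stdNormalCall (x : ℝ) : ℝ := stdNormalPDF x + x * stdNormalCDF x

theorem hasDerivAt_stdNormalCall (x : ℝ) : HasDerivAt stdNormalCall (stdNormalCDF x) x := by
  have h := (hasDerivAt_stdNormalPDF x).add ((hasDerivAt_id x).mul (hasDerivAt_stdNormalCDF x))
  refine h.congr_deriv ?_
  simp

theorem tendsto_stdNormalCall_atBot : Tendsto stdNormalCall atBot (𝓝 0) := by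
  simpa using! tendsto_stdNormalPDF_atBot.add tendsto_mul_stdNormalCDF_atBot

theorem stdNormalCall_nonneg (x : ℝ) : 0 ≤ stdNormalCall x :=
  nonneg_of_hasDerivAt_of_tendsto_atBot hasDerivAt_stdNormalCall stdNormalCDF_nonneg
    tendsto_stdNormalCall_atBot x

theorem lintegral_one_sub_stdNormalCDF_Ici (x : ℝ) :
    ∫⁻ y in Ici x, ENNReal.ofReal (1 - stdNormalCDF y) = ENNReal.ofReal (stdNormalCall (-x)) := by
  have hd : ∀ y ∈ Ici x, HasDerivAt (fun y => -stdNormalCall (-y)) (1 - stdNormalCDF y) y :=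
    fun y _ => by
      have h := ((hasDerivAt_stdNormalCall (-y)).scomp y (hasDerivAt_neg y)).neg
      refine h.congr_deriv ?_
      simp [stdNormalCDF_neg]
  have hlim : Tendsto (fun y => -stdNormalCall (-y)) atTop (𝓝 (-0)) :=
    (tendsto_stdNormalCall_atBot.comp tendsto_neg_atTop_atBot).neg
  have hint : IntegrableOn (fun y => 1 - stdNormalCDF y) (Ioi x) :=
    integrableOn_Ioi_deriv_of_nonneg' hd (fun y _ => sub_nonneg.2 (stdNormalCDF_le_one y)) hlim
  rw [← setLIntegral_congr Ioi_ae_eq_Ici, ← ofReal_integral_eq_lintegral_ofReal hint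
      (ae_of_all _ fun y => sub_nonneg.2 (stdNormalCDF_le_one y)),
    integral_Ioi_of_hasDerivAt_of_tendsto' hd hint hlim]
  simp

theorem lintegral_stdNormalCDF_Iic (x : ℝ) :
    ∫⁻ y in Iic x, ENNReal.ofReal (stdNormalCDF y) = ENNReal.ofReal (stdNormalCall x) := by
  have h := lintegral_one_sub_stdNormalCDF_Ici (-x)
  rw [neg_neg] at h
  rw [← h, ← (Measure.measurePreserving_neg volume).setLIntegral_comp_preimage measurableSet_Ici
    (continuous_stdNormalCDF.measurable.const_sub 1).ennreal_ofReal]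
  simp [stdNormalCDF_neg]

/-- The lower Mills bound for the normal tail. -/
theorem stdNormalCDF_add_nonneg (x : ℝ) :
    0 ≤ stdNormalCDF x + x / (1 + x ^ 2) * stdNormalPDF x := by
  have hpos : ∀ x : ℝ, 0 < 1 + x ^ 2 := fun x => by positivity
  -- The factor x / (1 + x²) leaves a derivative of constant sign, and the function vanishes at -∞.
  have hd : ∀ x, HasDerivAt (fun x => stdNormalCDF x + x / (1 + x ^ 2) * stdNormalPDF x)
      (2 / (1 + x ^ 2) ^ 2 * stdNormalPDF x) x := fun x => by
    have h := (hasDerivAt_stdNormalCDF x).add (((hasDerivAt_id x).div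
      (((hasDerivAt_id x).pow 2).const_add 1) (hpos x).ne').mul (hasDerivAt_stdNormalPDF x))
    refine h.congr_deriv ?_
    have := (hpos x).ne'
    simp
    field_simp
    ring
  refine nonneg_of_hasDerivAt_of_tendsto_atBot hd
    (fun x => mul_nonneg (by positivity) (stdNormalPDF_pos x).le) ?_ x
  have h0 : Tendsto (fun x => x / (1 + x ^ 2) * stdNormalPDF x) atBot (𝓝 0) := by
    refine squeeze_zero_norm (fun x => ?_) tendsto_stdNormalPDF_atBot
    rw [norm_mul, Real.norm_of_nonneg (stdNormalPDF_pos x).le]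
    refine mul_le_of_le_one_left (stdNormalPDF_pos x).le ?_
    rw [Real.norm_eq_abs, abs_div, abs_of_pos (hpos x), div_le_one (hpos x)]
    nlinarith [sq_abs x, sq_nonneg (|x| - 1)]
  simpa using tendsto_stdNormalCDF_atBot.add h0

/-- The ratio `Φ / φ`, which solves `u' = 1 + x u`. -/
noncomputable def millsRatio (x : ℝ) : ℝ := stdNormalCDF x / stdNormalPDF x

/-- The derivative of `millsRatio`. -/
noncomputable def millsDeriv (x : ℝ) : ℝ := 1 + x * millsRatio x

theorem hasDerivAt_millsRatio (x : ℝ) : HasDerivAt millsRatio (millsDeriv x) x := by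
  have h := (hasDerivAt_stdNormalCDF x).div (hasDerivAt_stdNormalPDF x) (stdNormalPDF_pos x).ne'
  refine h.congr_deriv ?_
  have := (stdNormalPDF_pos x).ne'
  rw [millsDeriv, millsRatio]
  field_simp
  ring

theorem continuous_millsRatio : Continuous millsRatio :=
  continuous_iff_continuousAt.2 fun x => (hasDerivAt_millsRatio x).continuousAt

theorem continuous_millsDeriv : Continuous millsDeriv :=
  continuous_const.add (continuous_id.mul continuous_millsRatio)

theorem stdNormalCall_eq (x : ℝ) : stdNormalCall x = stdNormalPDF x * millsDeriv x := by
  have := (stdNormalPDF_pos x).ne'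
  rw [stdNormalCall, millsDeriv, millsRatio]
  field_simp

theorem millsRatio_nonneg (x : ℝ) : 0 ≤ millsRatio x :=
  div_nonneg (stdNormalCDF_nonneg x) (stdNormalPDF_pos x).le

/-- φ u' is the integrated distribution function, hence nonnegative. -/
theorem millsDeriv_nonneg (x : ℝ) : 0 ≤ millsDeriv x :=
  nonneg_of_mul_nonneg_right (stdNormalCall_eq x ▸ stdNormalCall_nonneg x) (stdNormalPDF_pos x)

theorem monotone_millsRatio : Monotone millsRatio :=
  monotone_of_hasDerivAt_nonneg hasDerivAt_millsRatio millsDeriv_nonneg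

theorem millsDeriv_le_of_le {x c : ℝ} (h : x ≤ c) : millsDeriv x ≤ 1 + |c| * millsRatio c := by
  have h1 : x * millsRatio x ≤ |c| * millsRatio x :=
    mul_le_mul_of_nonneg_right (h.trans (le_abs_self c)) (millsRatio_nonneg x)
  have h2 : |c| * millsRatio x ≤ |c| * millsRatio c :=
    mul_le_mul_of_nonneg_left (monotone_millsRatio h) (abs_nonneg c)
  rw [millsDeriv]
  linarith

theorem millsDeriv_neg_le {x : ℝ} (hx : 0 ≤ x) : millsDeriv (-x) ≤ 1 / (1 + x ^ 2) := by
  have h := stdNormalCDF_add_nonneg (-x)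
  have hφ := stdNormalPDF_pos (-x)
  have h2 : x / (1 + x ^ 2) ≤ millsRatio (-x) := by
    rw [millsRatio, le_div_iff₀ hφ]
    have : -x / (1 + (-x) ^ 2) = -(x / (1 + x ^ 2)) := by rw [neg_sq, neg_div]
    rw [this] at h
    linarith
  have h3 := mul_le_mul_of_nonneg_left h2 hx
  have h4 : 1 - x * (x / (1 + x ^ 2)) = 1 / (1 + x ^ 2) := by
    have : (1 + x ^ 2) ≠ 0 := by positivity
    field_simp
    ring
  rw [millsDeriv]
  linarith

/-- The expression is even. For x ≥ 0, φ u' = φ + x Φ ≤ 1 + x, while the Mills bound gives u'(-x) ≤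
1 / (1 + x²); the decay of the second factor absorbs the growth of the first. -/
theorem stdNormalPDF_mul_millsDeriv_mul_millsDeriv_neg_le (x : ℝ) :
    stdNormalPDF x * millsDeriv x * millsDeriv (-x) ≤ 2 := by
  wlog hx : 0 ≤ x with H
  · have h := H (-x) (by linarith)
    rw [stdNormalPDF_neg, neg_neg] at h
    linarith
  have h1 : stdNormalPDF x * millsDeriv x ≤ 1 + x := by
    rw [← stdNormalCall_eq, stdNormalCall]
    nlinarith [stdNormalPDF_le_one x, stdNormalCDF_le_one x]
  calc _ ≤ (1 + x) * (1 / (1 + x ^ 2)) :=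
        mul_le_mul h1 (millsDeriv_neg_le hx) (millsDeriv_nonneg _) (by linarith)
    _ ≤ 2 := by
        rw [mul_one_div, div_le_iff₀ (by positivity)]
        nlinarith [sq_nonneg (x - 1), sq_nonneg x]

/-- The absolute value of the derivative at `x` of the solution of Stein's equation for the
indicator of `Iic y`. -/
noncomputable def steinKernel (y x : ℝ) : ℝ :=
  if x ≤ y then (1 - stdNormalCDF y) * millsDeriv x else stdNormalCDF y * millsDeriv (-x)

theorem steinKernel_nonneg (y x : ℝ) : 0 ≤ steinKernel y x := by
  rw [steinKernel]
  split_ifs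
  · exact mul_nonneg (sub_nonneg.2 (stdNormalCDF_le_one y)) (millsDeriv_nonneg x)
  · exact mul_nonneg (stdNormalCDF_nonneg y) (millsDeriv_nonneg _)

theorem measurable_steinKernel : Measurable (Function.uncurry steinKernel) := by
  have h1 := continuous_stdNormalCDF
  have h2 := continuous_millsDeriv
  refine Measurable.ite (measurableSet_le measurable_snd measurable_fst) ?_ ?_
  · exact Continuous.measurable (by fun_prop)
  · exact Continuous.measurable (by fun_prop)

/-- On each side of x the variable y enters only through a normal tail, whose integral is φ(x)
u'(∓x). Both sides therefore contribute φ(x) u'(x) u'(-x) ≤ 2. -/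
theorem lintegral_steinKernel_le (x : ℝ) : ∫⁻ y, ENNReal.ofReal (steinKernel y x) ≤ 4 := by
  have h1 : ∫⁻ y in Ici x, ENNReal.ofReal (steinKernel y x) =
      ENNReal.ofReal (millsDeriv x) * ENNReal.ofReal (stdNormalCall (-x)) := by
    rw [← lintegral_one_sub_stdNormalCDF_Ici, ← lintegral_const_mul' _ _ ENNReal.ofReal_ne_top]
    refine setLIntegral_congr_fun measurableSet_Ici fun y hy => ?_
    rw [steinKernel, if_pos hy.out, mul_comm, ENNReal.ofReal_mul (millsDeriv_nonneg x)]
  have h2 : ∫⁻ y in Iio x, ENNReal.ofReal (steinKernel y x) =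
      ENNReal.ofReal (millsDeriv (-x)) * ENNReal.ofReal (stdNormalCall x) := by
    rw [← lintegral_stdNormalCDF_Iic, ← lintegral_const_mul' _ _ ENNReal.ofReal_ne_top,
      ← setLIntegral_congr Iio_ae_eq_Iic]
    refine setLIntegral_congr_fun measurableSet_Iio fun y hy => ?_
    rw [steinKernel, if_neg (not_le.2 hy.out), mul_comm, ENNReal.ofReal_mul (millsDeriv_nonneg _)]
  rw [← lintegral_add_compl _ measurableSet_Ici, compl_Ici, h1, h2, stdNormalCall_eq,
    stdNormalCall_eq, stdNormalPDF_neg, ← ENNReal.ofReal_mul (millsDeriv_nonneg _),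
    ← ENNReal.ofReal_mul (millsDeriv_nonneg _), ← ENNReal.ofReal_add]
  · refine ENNReal.ofReal_le_of_le_toReal ?_
    have := stdNormalPDF_mul_millsDeriv_mul_millsDeriv_neg_le x
    simp only [ENNReal.toReal_ofNat]
    nlinarith
  all_goals
    have := millsDeriv_nonneg x
    have := millsDeriv_nonneg (-x)
    have := (stdNormalPDF_pos x).le
    positivity

end GaussianMills

/-! ### Gamma densities: moments, derivative and convolution. -/

section GammaLaw

open Set Filter Topology

/-- Size-biasing raises the shape by one. Moments and the Stein kernel both follow from this. -/
theorem mul_gammaPDFReal {a r : ℝ} (ha : 0 < a) (hr : 0 < r) (s : ℝ) :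
    s * gammaPDFReal a r s = a / r * gammaPDFReal (a + 1) r s := by
  have hΓ := (Real.Gamma_pos_of_pos ha).ne'
  unfold gammaPDFReal
  split_ifs with hs
  · rw [Real.Gamma_add_one ha.ne', Real.rpow_add_one hr.ne', add_sub_cancel_right]
    rcases hs.eq_or_lt with rfl | hs
    · simp [Real.zero_rpow ha.ne']
    · rw [Real.rpow_sub_one hs.ne']
      field_simp
  · simp

theorem integrable_gammaPDFReal {a r : ℝ} (ha : 0 < a) (hr : 0 < r) :
    Integrable (gammaPDFReal a r) := by
  refine ⟨(measurable_gammaPDFReal a r).aestronglyMeasurable, ?_⟩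
  rw [hasFiniteIntegral_iff_ofReal (ae_of_all _ (gammaPDFReal_nonneg ha hr))]
  exact (lintegral_gammaPDF_eq_one ha hr).trans_lt ENNReal.one_lt_top

theorem integral_gammaPDFReal {a r : ℝ} (ha : 0 < a) (hr : 0 < r) :
    ∫ s, gammaPDFReal a r s = 1 := by
  rw [integral_eq_lintegral_of_nonneg_ae (ae_of_all _ (gammaPDFReal_nonneg ha hr))
    (measurable_gammaPDFReal a r).aestronglyMeasurable]
  exact (congrArg ENNReal.toReal (lintegral_gammaPDF_eq_one ha hr)).trans ENNReal.toReal_one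

theorem sq_mul_gammaPDFReal {a r : ℝ} (ha : 0 < a) (hr : 0 < r) (s : ℝ) :
    s ^ 2 * gammaPDFReal a r s = a * (a + 1) / r ^ 2 * gammaPDFReal (a + 1 + 1) r s := by
  have h1 := mul_gammaPDFReal ha hr s
  have h2 := mul_gammaPDFReal (by linarith : 0 < a + 1) hr s
  calc s ^ 2 * gammaPDFReal a r s = s * (s * gammaPDFReal a r s) := by ring
    _ = a / r * (s * gammaPDFReal (a + 1) r s) := by rw [h1]; ring
    _ = _ := by rw [h2]; field_simp

theorem integrable_mul_gammaPDFReal {a r : ℝ} (ha : 0 < a) (hr : 0 < r) :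
    Integrable fun s => s * gammaPDFReal a r s := by
  simp_rw [mul_gammaPDFReal ha hr]
  exact (integrable_gammaPDFReal (by linarith) hr).const_mul _

theorem integral_mul_gammaPDFReal {a r : ℝ} (ha : 0 < a) (hr : 0 < r) :
    ∫ s, s * gammaPDFReal a r s = a / r := by
  simp_rw [mul_gammaPDFReal ha hr]
  rw [integral_const_mul, integral_gammaPDFReal (by linarith) hr, mul_one]

theorem integrable_sq_mul_gammaPDFReal {a r : ℝ} (ha : 0 < a) (hr : 0 < r) :
    Integrable fun s => s ^ 2 * gammaPDFReal a r s := by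
  simp_rw [sq_mul_gammaPDFReal ha hr]
  exact (integrable_gammaPDFReal (by linarith) hr).const_mul _

theorem integral_sq_mul_gammaPDFReal {a r : ℝ} (ha : 0 < a) (hr : 0 < r) :
    ∫ s, s ^ 2 * gammaPDFReal a r s = a * (a + 1) / r ^ 2 := by
  simp_rw [sq_mul_gammaPDFReal ha hr]
  rw [integral_const_mul, integral_gammaPDFReal (by linarith) hr, mul_one]

theorem integral_affine_sq_mul_gammaPDFReal {a r : ℝ} (ha : 0 < a) (hr : 0 < r) (c d : ℝ) :
    Integrable (fun s => (c * s + d) ^ 2 * gammaPDFReal a r s) ∧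
    ∫ s, (c * s + d) ^ 2 * gammaPDFReal a r s =
      c ^ 2 * (a * (a + 1) / r ^ 2) + 2 * c * d * (a / r) + d ^ 2 := by
  have h : (fun s => (c * s + d) ^ 2 * gammaPDFReal a r s) = fun s =>
      c ^ 2 * (s ^ 2 * gammaPDFReal a r s) + 2 * c * d * (s * gammaPDFReal a r s) +
        d ^ 2 * gammaPDFReal a r s := by
    ext s
    ring
  have h2 := (integrable_sq_mul_gammaPDFReal ha hr).const_mul (c ^ 2)
  have h1 := (integrable_mul_gammaPDFReal ha hr).const_mul (2 * c * d)
  have h0 := (integrable_gammaPDFReal ha hr).const_mul (d ^ 2)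
  rw [h]
  have h21 := h2.add h1
  refine ⟨h21.add h0, ?_⟩
  rw [integral_add (by exact h21) h0, integral_add h2 h1, integral_const_mul, integral_const_mul,
    integral_const_mul, integral_sq_mul_gammaPDFReal ha hr, integral_mul_gammaPDFReal ha hr,
    integral_gammaPDFReal ha hr, mul_one]

/-- The two half-lines are treated separately and glued at 0, where a > 1 makes both one-sided
derivatives vanish. -/
theorem hasDerivAt_gammaPDFReal_add_one {a r : ℝ} (ha : 1 < a) (hr : 0 < r) (s : ℝ) :
    HasDerivAt (gammaPDFReal (a + 1) r)
      (r * (gammaPDFReal a r s - gammaPDFReal (a + 1) r s)) s := by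
  have ha0 : 0 < a := by linarith
  have hΓ := (Real.Gamma_pos_of_pos ha0).ne'
  have hneg : ∀ s ≤ 0, ∀ b > 1, gammaPDFReal b r s = 0 := by
    intro s hs b hb
    rcases hs.eq_or_lt with rfl | hs
    · simp [gammaPDFReal, Real.zero_rpow (by linarith : b - 1 ≠ 0)]
    · simp [gammaPDFReal, not_le.2 hs]
  have hleft : ∀ s ≤ 0, HasDerivWithinAt (gammaPDFReal (a + 1) r)
      (r * (gammaPDFReal a r s - gammaPDFReal (a + 1) r s)) (Iic 0) s := by
    intro s hs
    rw [hneg s hs a ha, hneg s hs _ (by linarith), sub_self, mul_zero]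
    exact (hasDerivWithinAt_const s (Iic 0) (0 : ℝ)).congr
      (fun t ht => hneg t ht _ (by linarith)) (hneg s hs _ (by linarith))
  have hright : ∀ s, 0 ≤ s → HasDerivWithinAt (gammaPDFReal (a + 1) r)
      (r * (gammaPDFReal a r s - gammaPDFReal (a + 1) r s)) (Ici 0) s := by
    intro s hs
    have h := (((Real.hasDerivAt_rpow_const (x := s) (p := a) (Or.inr ha.le)).const_mul
      (r ^ (a + 1) / Real.Gamma (a + 1))).mul
        (((hasDerivAt_id s).const_mul r).neg.exp)).hasDerivWithinAt (s := Ici 0)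
    have heq : ∀ t ∈ Ici (0 : ℝ), gammaPDFReal (a + 1) r t = r ^ (a + 1) / Real.Gamma (a + 1) *
        t ^ a * Real.exp (-(r * t)) := fun t ht => by simp [gammaPDFReal, mem_Ici.1 ht]
    have h' := h.congr heq (heq s hs)
    refine h'.congr_deriv ?_
    simp only [gammaPDFReal, if_pos hs, Real.Gamma_add_one ha0.ne', Real.rpow_add_one hr.ne',
      add_sub_cancel_right]
    simp
    field_simp
    ring
  rcases lt_trichotomy s 0 with hs | rfl | hs
  · exact (hleft s hs.le).hasDerivAt (Iic_mem_nhds hs)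
  · simpa using (hleft 0 le_rfl).union (hright 0 le_rfl)
  · exact (hright s hs.le).hasDerivAt (Ici_mem_nhds hs)

theorem tendsto_gammaPDFReal_add_one_atTop (a : ℝ) {r : ℝ} (hr : 0 < r) :
    Tendsto (gammaPDFReal (a + 1) r) atTop (𝓝 0) := by
  have h := (tendsto_rpow_mul_exp_neg_mul_atTop_nhds_zero a r hr).const_mul
    (r ^ (a + 1) / Real.Gamma (a + 1))
  rw [mul_zero] at h
  refine h.congr' ?_
  filter_upwards [eventually_ge_atTop 0] with s hs
  simp [gammaPDFReal, hs, mul_assoc]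

/-- The exponentials multiply to exp (-r x), free of y, so only the integral of y^(a-1) over [0, x]
remains. -/
theorem gammaMeasure_conv_expMeasure {a r : ℝ} (ha : 0 < a) (hr : 0 < r) :
    gammaMeasure a r ∗ expMeasure r = gammaMeasure (a + 1) r := by
  rw [expMeasure, gammaMeasure, gammaMeasure, gammaMeasure, conv_withDensity_eq_lconvolution
    (f := gammaPDF a r) (g := gammaPDF 1 r) (measurable_gammaPDFReal _ _).ennreal_ofReal
    (measurable_gammaPDFReal _ _).ennreal_ofReal]
  congr 1
  ext x
  have hΓ := (Real.Gamma_pos_of_pos ha)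
  set C := r ^ a / Real.Gamma a * r * Real.exp (-(r * x)) with hC
  have hC0 : 0 ≤ C := by positivity
  have hprod : ∀ y, gammaPDF a r y * gammaPDF 1 r (-y + x) =
      (Icc 0 x).indicator (fun y => ENNReal.ofReal (C * y ^ (a - 1))) y := by
    intro y
    by_cases hy : y ∈ Icc 0 x
    · rw [indicator_of_mem hy, gammaPDF_of_nonneg hy.1, gammaPDF_of_nonneg (by linarith [hy.2]),
        ← ENNReal.ofReal_mul (by have := hy.1; positivity), hC]
      congr 1
      have : Real.exp (-(r * x)) = Real.exp (-(r * y)) * Real.exp (-(r * (-y + x))) := by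
        rw [← Real.exp_add]
        congr 1
        ring
      rw [this]
      simp
      ring
    · rw [indicator_of_notMem hy]
      rcases lt_or_ge y 0 with h | h
      · rw [gammaPDF_of_neg h, zero_mul]
      · have : x < y := not_le.1 fun h' => hy ⟨h, h'⟩
        rw [gammaPDF_of_neg (by linarith : -y + x < 0), mul_zero]
  rw [lconvolution_def]
  simp_rw [hprod]
  rw [lintegral_indicator measurableSet_Icc]
  rcases lt_or_ge x 0 with hx | hx
  · rw [Icc_eq_empty (not_le.2 hx), gammaPDF_of_neg hx]
    simp
  · have hint : IntervalIntegrable (fun y : ℝ => C * y ^ (a - 1)) volume 0 x :=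
      (intervalIntegral.intervalIntegrable_rpow' (by linarith)).const_mul C
    have hint' : IntegrableOn (fun y : ℝ => C * y ^ (a - 1)) (Ioc 0 x) :=
      (intervalIntegrable_iff_integrableOn_Ioc_of_le hx).1 hint
    rw [← setLIntegral_congr Ioc_ae_eq_Icc, ← ofReal_integral_eq_lintegral_ofReal hint'
      ((ae_restrict_iff' measurableSet_Ioc).2 (ae_of_all _ fun y hy => by
        have := hy.1.le
        positivity)),
      ← intervalIntegral.integral_of_le hx, intervalIntegral.integral_const_mul,
      integral_rpow (Or.inl (by linarith)), gammaPDF_of_nonneg hx, hC,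
      Real.Gamma_add_one ha.ne', Real.rpow_add_one hr.ne']
    congr 1
    simp [Real.zero_rpow ha.ne']
    field_simp

theorem map_sum_exp_eq_gammaMeasure {Ω ι : Type*} [MeasurableSpace Ω] {μ : Measure Ω}
    [IsProbabilityMeasure μ] {r : ℝ} (hr : 0 < r) {X : ι → Ω → ℝ} (hindep : iIndepFun X μ)
    (hlaw : ∀ i, HasLaw (X i) (expMeasure r) μ) {s : Finset ι} (hs : s.Nonempty) :
    μ.map (∑ i ∈ s, X i) = gammaMeasure s.card r := by
  classical
  induction hs using Finset.Nonempty.cons_induction with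
  | singleton i => simpa using! (hlaw i).map_eq
  | cons i s hi hs ih =>
    have hind : IndepFun (∑ j ∈ s, X j) (X i) μ :=
      hindep.indepFun_finsetSum_of_notMem₀ (fun j => (hlaw j).aemeasurable) hi
    rw [Finset.sum_cons, add_comm, hind.map_add_eq_map_conv_map₀
      (Finset.aemeasurable_sum _ fun j _ => (hlaw j).aemeasurable) (hlaw i).aemeasurable, ih,
      (hlaw i).map_eq, gammaMeasure_conv_expMeasure (by exact_mod_cast hs.card_pos) hr,
      Finset.card_cons, Nat.cast_add_one]

end GammaLaw

/-! ### Stein's method for the standardised Gamma law. -/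

section GammaStein

open Set Filter Topology

/-- The affine map that standardises the Gamma law with shape `a` and rate `r`. -/
noncomputable def gammaStd (a r s : ℝ) : ℝ := (r * s - a) / √a

theorem hasDerivAt_gammaStd (a r s : ℝ) : HasDerivAt (gammaStd a r) (r / √a) s := by
  have h := (((hasDerivAt_id s).const_mul r).sub_const a).div_const (√a)
  simpa using! h

theorem continuous_gammaStd (a r : ℝ) : Continuous (gammaStd a r) :=
  continuous_iff_continuousAt.2 fun s => (hasDerivAt_gammaStd a r s).continuousAt

theorem gammaStd_le_gammaStd {a r s t : ℝ} (ha : 0 < a) (hr : 0 < r) :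
    gammaStd a r s ≤ gammaStd a r t ↔ s ≤ t := by
  rw [gammaStd, gammaStd, div_le_div_iff_of_pos_right (Real.sqrt_pos.2 ha), sub_le_sub_iff_right,
    mul_le_mul_iff_right₀ hr]

theorem gammaStd_surjective {a r : ℝ} (ha : 0 < a) (hr : 0 < r) :
    Function.Surjective (gammaStd a r) := fun y => by
  have := (Real.sqrt_pos.2 ha).ne'
  refine ⟨(a + √a * y) / r, ?_⟩
  rw [gammaStd]
  field_simp
  ring

theorem integral_gammaStd_sq {a r : ℝ} (ha : 0 < a) (hr : 0 < r) :
    Integrable (fun s => gammaStd a r s ^ 2 * gammaPDFReal a r s) ∧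
      ∫ s, gammaStd a r s ^ 2 * gammaPDFReal a r s = 1 := by
  have hsq := Real.sq_sqrt ha.le
  have h0 := (Real.sqrt_pos.2 ha).ne'
  obtain ⟨h1, h2⟩ := integral_affine_sq_mul_gammaPDFReal ha hr (r / √a) (-√a)
  have h : ∀ s, gammaStd a r s = r / √a * s + -√a := fun s => by
    rw [gammaStd]
    field_simp
    rw [hsq]
    ring
  simp_rw [h]
  refine ⟨h1, h2.trans ?_⟩
  have h4 : √a ^ 4 = a ^ 2 := by
    rw [show √a ^ 4 = (√a ^ 2) ^ 2 by ring, hsq]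
  field_simp
  ring_nf
  rw [h4, hsq]
  ring

theorem integrable_abs_gammaStd {a r : ℝ} (ha : 0 < a) (hr : 0 < r) :
    Integrable (fun s => |gammaStd a r s| * gammaPDFReal a r s) := by
  refine ((integral_gammaStd_sq ha hr).1.add (integrable_gammaPDFReal ha hr)).mono'
    ((continuous_gammaStd a r).abs.measurable.mul (measurable_gammaPDFReal a r)).aestronglyMeasurable
    (ae_of_all _ fun s => ?_)
  have h := gammaPDFReal_nonneg ha hr s
  rw [Real.norm_of_nonneg (mul_nonneg (abs_nonneg _) h)]
  simp only [Pi.add_apply]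
  nlinarith [mul_nonneg h (sq_nonneg (|gammaStd a r s| - 1)), sq_abs (gammaStd a r s),
    mul_nonneg h (abs_nonneg (gammaStd a r s))]

/-- Uses |w| ≤ (w² + 1) / 2 and unit variance. -/
theorem integral_abs_gammaStd_le {a r : ℝ} (ha : 0 < a) (hr : 0 < r) :
    ∫ s, |gammaStd a r s| * gammaPDFReal a r s ≤ 1 := by
  have hi := integral_gammaStd_sq ha hr
  have h : ∫ s, |gammaStd a r s| * gammaPDFReal a r s ≤
      ∫ s, (1 / 2 * (gammaStd a r s ^ 2 * gammaPDFReal a r s) + 1 / 2 * gammaPDFReal a r s) := by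
    refine integral_mono (integrable_abs_gammaStd ha hr)
      ((hi.1.const_mul _).add ((integrable_gammaPDFReal ha hr).const_mul _)) fun s => ?_
    have h := gammaPDFReal_nonneg ha hr s
    simp only []
    nlinarith [mul_nonneg h (sq_nonneg (|gammaStd a r s| - 1)), sq_abs (gammaStd a r s)]
  rw [integral_add (hi.1.const_mul _) ((integrable_gammaPDFReal ha hr).const_mul _),
    integral_const_mul, integral_const_mul, hi.2, integral_gammaPDFReal ha hr] at h
  linarith

/-- The Stein kernel times the density of the Gamma law, in the standardised scale. -/
noncomputable def gammaSteinPDF (a r s : ℝ) : ℝ := √a / r * gammaPDFReal (a + 1) r s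

theorem gammaSteinPDF_eq {a r : ℝ} (ha : 0 < a) (hr : 0 < r) (s : ℝ) :
    gammaSteinPDF a r s = √a / r * (1 + gammaStd a r s / √a) * gammaPDFReal a r s := by
  have h := mul_gammaPDFReal ha hr s
  have h0 := (Real.sqrt_pos.2 ha).ne'
  have h1 : gammaPDFReal (a + 1) r s = r * s / a * gammaPDFReal a r s := by
    field_simp at h ⊢
    linarith
  rw [gammaSteinPDF, h1, gammaStd, div_div, Real.mul_self_sqrt ha.le]
  field_simp
  ring

theorem hasDerivAt_gammaSteinPDF {a r : ℝ} (ha : 1 < a) (hr : 0 < r) (s : ℝ) :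
    HasDerivAt (gammaSteinPDF a r) (-(gammaStd a r s * gammaPDFReal a r s)) s := by
  have ha0 : 0 < a := by linarith
  have h := (hasDerivAt_gammaPDFReal_add_one ha hr s).const_mul (√a / r)
  refine h.congr_deriv ?_
  have h2 := gammaSteinPDF_eq ha0 hr s
  have h0 := (Real.sqrt_pos.2 ha0).ne'
  rw [gammaSteinPDF] at h2
  calc √a / r * (r * (gammaPDFReal a r s - gammaPDFReal (a + 1) r s))
      = √a * gammaPDFReal a r s - r * (√a / r * gammaPDFReal (a + 1) r s) := by field_simp
    _ = _ := by
      rw [h2]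
      field_simp
      ring

/-- The Stein identity before integration; keeping it as a derivative allows integration over
half-lines with boundary terms. -/
theorem hasDerivAt_comp_gammaStd_mul {a r : ℝ} (ha : 1 < a) (hr : 0 < r) {f f' : ℝ → ℝ}
    (hf : ∀ x, HasDerivAt f (f' x) x) (s : ℝ) :
    HasDerivAt (fun s => f (gammaStd a r s) * gammaSteinPDF a r s)
      (((1 + gammaStd a r s / √a) * f' (gammaStd a r s) - gammaStd a r s * f (gammaStd a r s)) *
        gammaPDFReal a r s) s := by
  have ha0 : 0 < a := by linarith
  have h := ((hf _).comp s (hasDerivAt_gammaStd a r s)).mul (hasDerivAt_gammaSteinPDF ha hr s)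
  refine h.congr_deriv ?_
  have h0 := (Real.sqrt_pos.2 ha0).ne'
  rw [gammaSteinPDF_eq ha0 hr]
  simp only [Function.comp]
  field_simp
  ring

theorem integrableOn_gammaStd_mul {a r : ℝ} (ha : 0 < a) (hr : 0 < r) {f : ℝ → ℝ}
    (hf : Continuous f) {t : Set ℝ} (ht : MeasurableSet t) {C : ℝ}
    (hC : ∀ s ∈ t, |f (gammaStd a r s)| ≤ C) :
    IntegrableOn (fun s => gammaStd a r s * f (gammaStd a r s) * gammaPDFReal a r s) t := by
  have hm : Measurable fun s => gammaStd a r s * f (gammaStd a r s) * gammaPDFReal a r s :=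
    ((continuous_gammaStd a r).mul (hf.comp (continuous_gammaStd a r))).measurable.mul
      (measurable_gammaPDFReal a r)
  refine ((integrable_abs_gammaStd ha hr).const_mul C).integrableOn.mono'
    hm.aestronglyMeasurable ((ae_restrict_iff' ht).2 (ae_of_all _ fun s hs => ?_))
  have h := gammaPDFReal_nonneg ha hr s
  rw [norm_mul, norm_mul, Real.norm_of_nonneg h, Real.norm_eq_abs, Real.norm_eq_abs]
  nlinarith [mul_le_mul_of_nonneg_left (hC s hs) (mul_nonneg h (abs_nonneg (gammaStd a r s)))]

theorem tendsto_gammaSteinPDF_atTop (a : ℝ) {r : ℝ} (hr : 0 < r) :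
    Tendsto (gammaSteinPDF a r) atTop (𝓝 0) := by
  simpa using! (tendsto_gammaPDFReal_add_one_atTop a hr).const_mul (√a / r)

theorem gammaSteinPDF_of_neg {a r s : ℝ} (hs : s < 0) : gammaSteinPDF a r s = 0 := by
  simp [gammaSteinPDF, gammaPDFReal, not_le.2 hs]

theorem integrableOn_Iic_gammaStd_millsDeriv {a r : ℝ} (ha : 1 < a) (hr : 0 < r) (t : ℝ) :
    IntegrableOn (fun s => gammaStd a r s * millsDeriv (gammaStd a r s) * gammaPDFReal a r s)
      (Iic t) := by
  have ha0 : 0 < a := by linarith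
  refine integrableOn_gammaStd_mul (C := 1 + |gammaStd a r t| * millsRatio (gammaStd a r t))
    ha0 hr continuous_millsDeriv measurableSet_Iic fun s hs => ?_
  rw [abs_of_nonneg (millsDeriv_nonneg _)]
  exact millsDeriv_le_of_le ((gammaStd_le_gammaStd ha0 hr).2 hs)

theorem integrableOn_Ioi_gammaStd_millsDeriv {a r : ℝ} (ha : 1 < a) (hr : 0 < r) (t : ℝ) :
    IntegrableOn (fun s => gammaStd a r s * millsDeriv (-gammaStd a r s) * gammaPDFReal a r s)
      (Ioi t) := by
  have ha0 : 0 < a := by linarith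
  refine integrableOn_gammaStd_mul (f := fun x => millsDeriv (-x))
    (C := 1 + |-gammaStd a r t| * millsRatio (-gammaStd a r t)) ha0 hr
    (continuous_millsDeriv.comp continuous_neg) measurableSet_Ioi fun s hs => ?_
  rw [abs_of_nonneg (millsDeriv_nonneg _)]
  exact millsDeriv_le_of_le (neg_le_neg ((gammaStd_le_gammaStd ha0 hr).2 (mem_Ioi.1 hs).le))

/-- With f = u, the equation u' = 1 + x u turns (1 + w / √a) u' - w u into 1 + w u' / √a. Nothing
comes from -∞, as the density vanishes for s < 0. -/
theorem integral_Iic_gammaStd_millsDeriv {a r : ℝ} (ha : 1 < a) (hr : 0 < r) (t : ℝ) :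
    (∫ s in Iic t, gammaPDFReal a r s) + (√a)⁻¹ *
      ∫ s in Iic t, gammaStd a r s * millsDeriv (gammaStd a r s) * gammaPDFReal a r s =
    millsRatio (gammaStd a r t) * gammaSteinPDF a r t := by
  have ha0 : 0 < a := by linarith
  have hi0 : IntegrableOn (gammaPDFReal a r) (Iic t) :=
    (integrable_gammaPDFReal ha0 hr).integrableOn
  have hi1 := (integrableOn_Iic_gammaStd_millsDeriv ha hr t).const_mul (√a)⁻¹
  have hd : ∀ s ∈ Iic t, HasDerivAt (fun s => millsRatio (gammaStd a r s) * gammaSteinPDF a r s)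
      (gammaPDFReal a r s + (√a)⁻¹ *
        (gammaStd a r s * millsDeriv (gammaStd a r s) * gammaPDFReal a r s)) s := fun s _ => by
    refine (hasDerivAt_comp_gammaStd_mul ha hr hasDerivAt_millsRatio s).congr_deriv ?_
    rw [millsDeriv]
    ring
  have hlim : Tendsto (fun s => millsRatio (gammaStd a r s) * gammaSteinPDF a r s) atBot (𝓝 0) := by
    refine tendsto_const_nhds.congr' ?_
    filter_upwards [eventually_lt_atBot 0] with s hs
    rw [gammaSteinPDF_of_neg hs, mul_zero]
  rw [← integral_const_mul, ← integral_add hi0 hi1,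
    integral_Iic_of_hasDerivAt_of_tendsto' hd (hi0.add hi1) hlim, sub_zero]

theorem integral_Ioi_gammaStd_millsDeriv {a r : ℝ} (ha : 1 < a) (hr : 0 < r) (t : ℝ) :
    (∫ s in Ioi t, gammaPDFReal a r s) + (√a)⁻¹ *
      ∫ s in Ioi t, gammaStd a r s * millsDeriv (-gammaStd a r s) * gammaPDFReal a r s =
    millsRatio (-gammaStd a r t) * gammaSteinPDF a r t := by
  have ha0 : 0 < a := by linarith
  have hi0 : IntegrableOn (gammaPDFReal a r) (Ioi t) :=
    (integrable_gammaPDFReal ha0 hr).integrableOn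
  have hi1 := (integrableOn_Ioi_gammaStd_millsDeriv ha hr t).const_mul (√a)⁻¹
  have hd : ∀ s ∈ Ici t,
      HasDerivAt (fun s => -(millsRatio (-gammaStd a r s) * gammaSteinPDF a r s))
      (gammaPDFReal a r s + (√a)⁻¹ *
        (gammaStd a r s * millsDeriv (-gammaStd a r s) * gammaPDFReal a r s)) s := fun s _ => by
    have hv : ∀ x, HasDerivAt (fun x => millsRatio (-x)) (-millsDeriv (-x)) x := fun x => by
      simpa using! (hasDerivAt_millsRatio (-x)).comp x (hasDerivAt_neg x)
    refine (hasDerivAt_comp_gammaStd_mul ha hr hv s).neg.congr_deriv ?_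
    rw [millsDeriv]
    ring
  have hlim : Tendsto (fun s => -(millsRatio (-gammaStd a r s) * gammaSteinPDF a r s)) atTop
      (𝓝 0) := by
    -- Since u is increasing, u(-w(s)) is at most its value at t, so the decay of the density
    -- suffices.
    have h := (tendsto_gammaSteinPDF_atTop a hr).const_mul (millsRatio (-gammaStd a r t))
    rw [mul_zero] at h
    refine squeeze_zero_norm' ?_ h
    filter_upwards [eventually_ge_atTop t] with s hs
    have h0 : 0 ≤ gammaSteinPDF a r s :=
      mul_nonneg (by positivity) (gammaPDFReal_nonneg (by linarith) hr s)
    rw [norm_neg, Real.norm_of_nonneg (mul_nonneg (millsRatio_nonneg _) h0)]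
    exact mul_le_mul_of_nonneg_right
      (monotone_millsRatio (neg_le_neg ((gammaStd_le_gammaStd ha0 hr).2 hs))) h0
  rw [← integral_const_mul, ← integral_add hi0 hi1,
    integral_Ioi_of_hasDerivAt_of_tendsto' hd (hi0.add hi1) hlim]
  ring

/-- The pointwise error in the normal approximation of a standardised Gamma law. -/
theorem abs_cdf_sub_stdNormalCDF_le {a r : ℝ} (ha : 1 < a) (hr : 0 < r) (t : ℝ) :
    Integrable (fun s => |gammaStd a r s| * steinKernel (gammaStd a r t) (gammaStd a r s) *
      gammaPDFReal a r s) ∧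
    |(∫ s in Iic t, gammaPDFReal a r s) - stdNormalCDF (gammaStd a r t)| ≤ (√a)⁻¹ *
      ∫ s, |gammaStd a r s| * steinKernel (gammaStd a r t) (gammaStd a r s) *
        gammaPDFReal a r s := by
  have ha0 : 0 < a := by linarith
  set G := stdNormalCDF (gammaStd a r t) with hG
  set w := gammaStd a r with hw
  have hG0 : 0 ≤ G := stdNormalCDF_nonneg _
  have hG1 : 0 ≤ 1 - G := sub_nonneg.2 (stdNormalCDF_le_one _)
  have hi1 := integrableOn_Iic_gammaStd_millsDeriv ha hr t
  have hi2 := integrableOn_Ioi_gammaStd_millsDeriv ha hr t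
  have e1 := integral_Iic_gammaStd_millsDeriv ha hr t
  have e2 := integral_Ioi_gammaStd_millsDeriv ha hr t
  -- Continuity of f_y at y = w(t): the boundary terms of the two half-lines will cancel.
  have hu : (1 - G) * millsRatio (w t) = G * millsRatio (-w t) := by
    rw [millsRatio, millsRatio, stdNormalCDF_neg, stdNormalPDF_neg]
    ring
  have htot : (∫ s in Iic t, gammaPDFReal a r s) + ∫ s in Ioi t, gammaPDFReal a r s = 1 := by
    have hi := integrable_gammaPDFReal ha0 hr
    rw [← integral_gammaPDFReal ha0 hr,
      intervalIntegral.integral_Iic_add_Ioi hi.integrableOn hi.integrableOn]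
  have k1 : EqOn (fun s => |w s| * steinKernel (w t) (w s) * gammaPDFReal a r s)
      (fun s => (1 - G) * ‖w s * millsDeriv (w s) * gammaPDFReal a r s‖) (Iic t) := fun s hs => by
    have hle : w s ≤ w t := (gammaStd_le_gammaStd ha0 hr).2 hs
    simp only []
    rw [steinKernel, if_pos hle, norm_mul, norm_mul, Real.norm_of_nonneg (millsDeriv_nonneg _),
      Real.norm_of_nonneg (gammaPDFReal_nonneg ha0 hr s), Real.norm_eq_abs]
    ring
  have k2 : EqOn (fun s => |w s| * steinKernel (w t) (w s) * gammaPDFReal a r s)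
      (fun s => G * ‖w s * millsDeriv (-w s) * gammaPDFReal a r s‖) (Ioi t) := fun s hs => by
    have hlt : ¬w s ≤ w t := fun h => not_le.2 (mem_Ioi.1 hs) ((gammaStd_le_gammaStd ha0 hr).1 h)
    simp only []
    rw [steinKernel, if_neg hlt, norm_mul, norm_mul, Real.norm_of_nonneg (millsDeriv_nonneg _),
      Real.norm_of_nonneg (gammaPDFReal_nonneg ha0 hr s), Real.norm_eq_abs]
    ring
  have j1 := (integrableOn_congr_fun k1 measurableSet_Iic).2 (hi1.norm.const_mul (1 - G))
  have j2 := (integrableOn_congr_fun k2 measurableSet_Ioi).2 (hi2.norm.const_mul G)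
  have hint : Integrable (fun s => |w s| * steinKernel (w t) (w s) * gammaPDFReal a r s) := by
    rw [← integrableOn_univ, ← Iic_union_Ioi (a := t)]
    exact j1.union j2
  refine ⟨hint, ?_⟩
  rw [← intervalIntegral.integral_Iic_add_Ioi j1 j2, setIntegral_congr_fun measurableSet_Iic k1,
    setIntegral_congr_fun measurableSet_Ioi k2, integral_const_mul, integral_const_mul]
  have n1 := norm_integral_le_integral_norm (μ := volume.restrict (Iic t))
    fun s => w s * millsDeriv (w s) * gammaPDFReal a r s
  have n2 := norm_integral_le_integral_norm (μ := volume.restrict (Ioi t))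
    fun s => w s * millsDeriv (-w s) * gammaPDFReal a r s
  rw [Real.norm_eq_abs] at n1 n2
  set A := ∫ s in Iic t, w s * millsDeriv (w s) * gammaPDFReal a r s
  set B := ∫ s in Ioi t, w s * millsDeriv (-w s) * gammaPDFReal a r s
  set F := ∫ s in Iic t, gammaPDFReal a r s
  -- Weight the two half-line identities by 1 - G and G and subtract; (1 - G) F - G (1 - F) = F - G.
  have key : F - G = (√a)⁻¹ * (G * B - (1 - G) * A) := by
    have e3 := congrArg ((1 - G) * ·) e1
    have e4 := congrArg (G * ·) e2
    rw [← mul_assoc (1 - G), hu] at e3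
    rw [eq_sub_of_add_eq' htot] at e4
    linear_combination e3 - e4
  rw [key, abs_mul, abs_of_nonneg (by positivity : 0 ≤ (√a)⁻¹)]
  refine mul_le_mul_of_nonneg_left ?_ (by positivity)
  calc |G * B - (1 - G) * A| ≤ |G * B| + |(1 - G) * A| := abs_sub _ _
    _ = (1 - G) * |A| + G * |B| := by rw [abs_mul, abs_mul, abs_of_nonneg hG0, abs_of_nonneg hG1,
        add_comm]
    _ ≤ _ := by gcongr

theorem wassersteinDist_gammaStd_le {a r : ℝ} (ha : 1 < a) (hr : 0 < r) :
    wassersteinDist ((gammaMeasure a r).map (gammaStd a r)) (gaussianReal 0 1) ≤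
      ENNReal.ofReal (4 / √a) := by
  have ha0 : 0 < a := by linarith
  have hprob := isProbabilityMeasure_gammaMeasure ha0 hr
  have hw := (continuous_gammaStd a r).measurable
  have hprob' : IsProbabilityMeasure ((gammaMeasure a r).map (gammaStd a r)) :=
    Measure.isProbabilityMeasure_map hw.aemeasurable
  have hg := measurable_gammaPDFReal a r
  have hbound : ∀ y, ENNReal.ofReal |cdf ((gammaMeasure a r).map (gammaStd a r)) y -
      cdf (gaussianReal 0 1) y| ≤ ENNReal.ofReal (√a)⁻¹ *
        ∫⁻ s, ENNReal.ofReal (|gammaStd a r s| * gammaPDFReal a r s) *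
          ENNReal.ofReal (steinKernel y (gammaStd a r s)) := by
    intro y
    obtain ⟨t, rfl⟩ := gammaStd_surjective ha0 hr y
    obtain ⟨h1, h2⟩ := abs_cdf_sub_stdNormalCDF_le ha hr t
    have hc : cdf ((gammaMeasure a r).map (gammaStd a r)) (gammaStd a r t) =
        ∫ s in Iic t, gammaPDFReal a r s := by
      rw [← cdf_gammaMeasure_eq_integral ha0 hr, cdf_eq_real, cdf_eq_real,
        map_measureReal_apply hw measurableSet_Iic]
      congr 1
      ext s
      exact gammaStd_le_gammaStd ha0 hr
    rw [hc]
    refine (ENNReal.ofReal_le_ofReal h2).trans_eq ?_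
    rw [ENNReal.ofReal_mul (by positivity), ofReal_integral_eq_lintegral_ofReal h1
      (ae_of_all _ fun s => mul_nonneg (mul_nonneg (abs_nonneg _) (steinKernel_nonneg _ _))
        (gammaPDFReal_nonneg ha0 hr s))]
    congr 1
    refine lintegral_congr fun s => ?_
    rw [← ENNReal.ofReal_mul (mul_nonneg (abs_nonneg _) (gammaPDFReal_nonneg ha0 hr s))]
    congr 1
    ring
  have hK1 : Measurable fun p : ℝ × ℝ =>
      ENNReal.ofReal (|gammaStd a r p.2| * gammaPDFReal a r p.2) :=
    ((hw.abs.mul hg).comp measurable_snd).ennreal_ofReal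
  have hK2 : Measurable fun p : ℝ × ℝ => ENNReal.ofReal (steinKernel p.1 (gammaStd a r p.2)) :=
    (measurable_steinKernel.comp (measurable_fst.prodMk (hw.comp measurable_snd))).ennreal_ofReal
  calc wassersteinDist ((gammaMeasure a r).map (gammaStd a r)) (gaussianReal 0 1)
      ≤ ∫⁻ y, ENNReal.ofReal (√a)⁻¹ *
        ∫⁻ s, ENNReal.ofReal (|gammaStd a r s| * gammaPDFReal a r s) *
          ENNReal.ofReal (steinKernel y (gammaStd a r s)) :=
        (wassersteinDist_le_lintegral_cdf _ _).trans (lintegral_mono hbound)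
    _ = ENNReal.ofReal (√a)⁻¹ * ∫⁻ s, ENNReal.ofReal (|gammaStd a r s| * gammaPDFReal a r s) *
          ∫⁻ y, ENNReal.ofReal (steinKernel y (gammaStd a r s)) := by
        rw [lintegral_const_mul' _ _ ENNReal.ofReal_ne_top,
          lintegral_lintegral_swap (hK1.mul hK2).aemeasurable]
        simp_rw [lintegral_const_mul' _ _ ENNReal.ofReal_ne_top]
    _ ≤ ENNReal.ofReal (√a)⁻¹ *
          ∫⁻ s, ENNReal.ofReal (|gammaStd a r s| * gammaPDFReal a r s) * 4 := by
        gcongr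
        exact lintegral_steinKernel_le _
    _ ≤ ENNReal.ofReal (√a)⁻¹ * (ENNReal.ofReal 1 * 4) := by
        rw [lintegral_mul_const' _ _ (by simp), ← ofReal_integral_eq_lintegral_ofReal
          (integrable_abs_gammaStd ha0 hr) (ae_of_all _ fun s =>
            mul_nonneg (abs_nonneg _) (gammaPDFReal_nonneg ha0 hr s))]
        gcongr
        exact integral_abs_gammaStd_le ha0 hr
    _ = ENNReal.ofReal (4 / √a) := by
        rw [ENNReal.ofReal_one, one_mul, div_eq_inv_mul, ENNReal.ofReal_mul (by positivity),
          ENNReal.ofReal_ofNat]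

end GammaStein

/-! ### Maximum likelihood and Fisher information of the exponential family. -/

section ExponentialMLE

open Set Filter Topology

theorem expMeanDensity_of_pos {θ x : ℝ} (hx : 0 < x) :
    expMeanDensity θ x = θ⁻¹ * Real.exp (-(x / θ)) := by
  simp [expMeanDensity, exponentialPDFReal, gammaPDFReal, hx.le, div_eq_inv_mul]

theorem likelihood_expMeanDensity {n : ℕ} (hn : n ≠ 0) {x : Fin n → ℝ} (hx : ∀ i, 0 < x i)
    (θ : ℝ) :
    likelihood expMeanDensity x θ = (θ⁻¹ * Real.exp (-((∑ i, x i) / n / θ))) ^ n := by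
  have hn' : (n : ℝ) ≠ 0 := Nat.cast_ne_zero.2 hn
  simp_rw [likelihood, expMeanDensity_of_pos (hx _)]
  rw [Finset.prod_mul_distrib, Finset.prod_const, ← Real.exp_sum, Finset.card_univ,
    Fintype.card_fin, mul_pow, ← Real.exp_nat_mul]
  congr 2
  rw [Finset.sum_neg_distrib, ← Finset.sum_div]
  field_simp

/-- With t = m / θ this is t < exp (t - 1) for t ≠ 1. As the likelihood is an n-th power of this
expression with m the sample mean, no calculus is needed. -/
theorem inv_mul_exp_neg_div_lt {m θ : ℝ} (hm : 0 < m) (hθ : 0 < θ) (hne : θ ≠ m) :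
    θ⁻¹ * Real.exp (-(m / θ)) < m⁻¹ * Real.exp (-(m / m)) := by
  have ht : m / θ - 1 ≠ 0 := fun h => hne (by
    rw [sub_eq_zero, div_eq_one_iff_eq hθ.ne'] at h
    exact h.symm)
  have h := Real.add_one_lt_exp ht
  rw [sub_add_cancel] at h
  have h2 : Real.exp (-(m / m)) = Real.exp (m / θ - 1) * Real.exp (-(m / θ)) := by
    rw [← Real.exp_add, div_self hm.ne']
    congr 1
    ring
  have h3 : θ⁻¹ = m⁻¹ * (m / θ) := by field_simp
  rw [h2, h3, ← mul_assoc]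
  gcongr

theorem isMaxLikelihoodEstimate_expMeanDensity_iff {n : ℕ} (hn : n ≠ 0) {x : Fin n → ℝ}
    (hx : ∀ i, 0 < x i) (θ : ℝ) :
    IsMaxLikelihoodEstimate expMeanDensity (Ioi 0) x θ ↔ θ = (∑ i, x i) / n := by
  have : Nonempty (Fin n) := ⟨⟨0, Nat.pos_of_ne_zero hn⟩⟩
  have hm : 0 < (∑ i, x i) / n :=
    div_pos (Finset.sum_pos (fun i _ => hx i) Finset.univ_nonempty)
      (Nat.cast_pos.2 (Nat.pos_of_ne_zero hn))
  have hlt : ∀ θ' > 0, θ' ≠ (∑ i, x i) / n → likelihood expMeanDensity x θ' <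
      likelihood expMeanDensity x ((∑ i, x i) / n) := fun θ' h1 h2 => by
    rw [likelihood_expMeanDensity hn hx, likelihood_expMeanDensity hn hx]
    exact pow_lt_pow_left₀ (inv_mul_exp_neg_div_lt hm h1 h2) (by positivity) hn
  constructor
  · rintro ⟨h1, h2⟩
    by_contra hne
    exact (h2 _ hm).not_gt (hlt θ h1 hne)
  · rintro rfl
    refine ⟨hm, fun θ' h1 => ?_⟩
    rcases eq_or_ne θ' ((∑ i, x i) / n) with h | h
    · rw [h]
    · exact (hlt θ' h1 h).le

theorem ae_expMeasure_pos {r : ℝ} (hr : 0 < r) : ∀ᵐ x ∂expMeasure r, 0 < x := by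
  have := isProbabilityMeasure_expMeasure hr
  have h : expMeasure r (Iic 0) = 0 := by
    rw [← ofReal_cdf, cdf_expMeasure_eq hr]
    simp
  rw [ae_iff]
  simpa [Iic] using! h

theorem integral_expMeasure {r : ℝ} (hr : 0 < r) (f : ℝ → ℝ) :
    ∫ x, f x ∂expMeasure r = ∫ x, f x * gammaPDFReal 1 r x := by
  rw [expMeasure, gammaMeasure, integral_withDensity_eq_integral_toReal_smul
    (f := gammaPDF 1 r) (measurable_gammaPDFReal 1 r).ennreal_ofReal (ae_of_all _ fun _ => ENNReal.ofReal_lt_top)]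
  refine integral_congr_ae (ae_of_all _ fun x => ?_)
  simp only []
  rw [gammaPDF, ENNReal.toReal_ofReal (gammaPDFReal_nonneg one_pos hr x), smul_eq_mul, mul_comm]

theorem fisherInformation_expMeanDensity {θ : ℝ} (hθ : 0 < θ) :
    fisherInformation expMeanDensity θ = 1 / θ ^ 2 := by
  have hr : 0 < 1 / θ := by positivity
  have hmeas : (volume.withDensity fun x => ENNReal.ofReal (expMeanDensity θ x)) =
      expMeasure (1 / θ) := rfl
  -- The formula is claimed only for x > 0, which is almost sure; for x < 0 the density is 0 and
  -- `Real.log` takes its default value.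
  have hscore : (fun x => deriv (fun t => Real.log (expMeanDensity t x)) θ)
      =ᵐ[expMeasure (1 / θ)] fun x => 1 / θ ^ 2 * x + -(1 / θ) := by
    filter_upwards [ae_expMeasure_pos hr] with x hx
    have hd : HasDerivAt (fun t => -Real.log t - x / t) (1 / θ ^ 2 * x + -(1 / θ)) θ := by
      have h := (Real.hasDerivAt_log hθ.ne').neg.sub
        ((hasDerivAt_const θ x).div (hasDerivAt_id θ) hθ.ne')
      refine h.congr_deriv ?_
      simp
      field_simp
      ring
    refine (hd.congr_of_eventuallyEq ?_).deriv
    filter_upwards [lt_mem_nhds hθ] with t ht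
    rw [expMeanDensity_of_pos hx, Real.log_mul (inv_ne_zero ht.ne') (Real.exp_ne_zero _),
      Real.log_inv, Real.log_exp]
    ring
  have hmean : ∫ x, (1 / θ ^ 2 * x + -(1 / θ)) ∂expMeasure (1 / θ) = 0 := by
    rw [integral_expMeasure hr]
    have h : ∀ x, (1 / θ ^ 2 * x + -(1 / θ)) * gammaPDFReal 1 (1 / θ) x =
        1 / θ ^ 2 * (x * gammaPDFReal 1 (1 / θ) x) + -(1 / θ) * gammaPDFReal 1 (1 / θ) x :=
      fun x => by ring
    simp_rw [h]
    rw [integral_add ((integrable_mul_gammaPDFReal one_pos hr).const_mul _)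
      ((integrable_gammaPDFReal one_pos hr).const_mul _), integral_const_mul, integral_const_mul,
      integral_mul_gammaPDFReal one_pos hr, integral_gammaPDFReal one_pos hr]
    field_simp
    ring
  rw [fisherInformation, hmeas, variance_congr hscore,
    variance_of_integral_eq_zero (by fun_prop) hmean, integral_expMeasure hr]
  refine (integral_affine_sq_mul_gammaPDFReal one_pos hr _ _).2.trans ?_
  field_simp
  ring

end ExponentialMLE

theorem corollaryA1 {Ω : Type*} [MeasurableSpace Ω] (μ : Measure Ω) [IsProbabilityMeasure μ]
    (θ₀ : ℝ) (hθ₀ : 0 < θ₀) (n : ℕ) (hn : 3 < n)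
    (X : Fin n → Ω → ℝ) (hindep : iIndepFun X μ)
    (hlaw : ∀ i, HasLaw (X i) (expMeasure (1 / θ₀)) μ)
    -- `θhat` is the maximum likelihood estimator, as a function of the sample
    (θhat : (Fin n → ℝ) → ℝ)
    (hθhat : ∀ x : Fin n → ℝ, (∀ i, 0 < x i) →
      IsMaxLikelihoodEstimate expMeanDensity (Set.Ioi 0) x (θhat x)) :
    -- the maximum likelihood estimate exists, is unique, and is the sample mean
    (∀ x : Fin n → ℝ, (∀ i, 0 < x i) → ∀ θ : ℝ,
      IsMaxLikelihoodEstimate expMeanDensity (Set.Ioi 0) x θ ↔ θ = (∑ i, x i) / n) ∧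
    -- the bound for `W = √(n i(θ₀)) (θhat(X) - θ₀)` and `Z ∼ N(0, 1)`
    wassersteinDist
        (μ.map fun ω => √(n * fisherInformation expMeanDensity θ₀) *
          (θhat (fun i => X i ω) - θ₀))
        (gaussianReal 0 1) <
      ENNReal.ofReal
        (10.41456 / √n
          + 4 * (n : ℝ) ^ (3 / 2 : ℝ) * (n + 6) / (((n : ℝ) - 1) * (n - 2) * (n - 3))
          + 6 / (n : ℝ) ^ (3 / 2 : ℝ)) := by
  have hn0 : n ≠ 0 := by omega
  have hnR : (3 : ℝ) < n := by exact_mod_cast hn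
  have hr : 0 < 1 / θ₀ := by positivity
  have hmle := fun (x : Fin n → ℝ) (hx : ∀ i, 0 < x i) (θ : ℝ) =>
    isMaxLikelihoodEstimate_expMeanDensity_iff hn0 hx θ
  refine ⟨hmle, ?_⟩
  have hpos : ∀ᵐ ω ∂μ, ∀ i, 0 < X i ω := by
    rw [ae_all_iff]
    intro i
    have h := ae_expMeasure_pos hr
    rw [← (hlaw i).map_eq] at h
    exact ae_of_ae_map (hlaw i).aemeasurable h
  -- With S the sum, (√n / θ₀) (S / n - θ₀) = (S / θ₀ - n) / √n. Equality is almost sure because the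
  -- values of `θhat` are prescribed only on positive samples.
  have hW : (fun ω => √(n * fisherInformation expMeanDensity θ₀) * (θhat (fun i => X i ω) - θ₀))
      =ᵐ[μ] fun ω => gammaStd n (1 / θ₀) ((∑ i, X i) ω) := by
    filter_upwards [hpos] with ω hω
    have hs : √(n : ℝ) ≠ 0 := (Real.sqrt_pos.2 (by linarith)).ne'
    have hsq : √(n : ℝ) ^ 2 = n := Real.sq_sqrt (by linarith)
    rw [(hmle _ hω _).1 (hθhat _ hω), fisherInformation_expMeanDensity hθ₀,
      Real.sqrt_mul (by linarith), Real.sqrt_div zero_le_one, Real.sqrt_one, Real.sqrt_sq hθ₀.le,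
      Finset.sum_apply, gammaStd]
    have hn' : (n : ℝ) ≠ 0 := by linarith
    field_simp
    rw [hsq]
  have hsum : AEMeasurable (∑ i, X i) μ :=
    Finset.aemeasurable_sum _ fun i _ => (hlaw i).aemeasurable
  have : Nonempty (Fin n) := ⟨⟨0, by omega⟩⟩
  have hmap : μ.map (fun ω => gammaStd n (1 / θ₀) ((∑ i, X i) ω)) =
      (gammaMeasure n (1 / θ₀)).map (gammaStd n (1 / θ₀)) := by
    have h := map_sum_exp_eq_gammaMeasure hr hindep hlaw Finset.univ_nonempty
    rw [Finset.card_univ, Fintype.card_fin] at h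
    rw [← h, AEMeasurable.map_map_of_aemeasurable
      (continuous_gammaStd _ _).measurable.aemeasurable hsum]
    rfl
  rw [Measure.map_congr hW, hmap]
  refine (wassersteinDist_gammaStd_le (by linarith) hr).trans_lt ?_
  have hs : 0 < √(n : ℝ) := Real.sqrt_pos.2 (by linarith)
  have h1 : 0 < (n : ℝ) - 1 := by linarith
  have h2 : 0 < (n : ℝ) - 2 := by linarith
  have h3 : 0 < (n : ℝ) - 3 := by linarith
  -- Strictness comes from 4 < 10.41456 alone.
  have h4 : 4 / √(n : ℝ) < 10.41456 / √n := by
    gcongr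
    norm_num
  have h5 : 0 ≤ 4 * (n : ℝ) ^ (3 / 2 : ℝ) * (n + 6) / (((n : ℝ) - 1) * (n - 2) * (n - 3)) := by
    positivity
  have h6 : 0 ≤ 6 / (n : ℝ) ^ (3 / 2 : ℝ) := by positivity
  exact (ENNReal.ofReal_lt_ofReal_iff (by positivity)).2 (by linarith)
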